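/- Let $G\subset GL_n(\mathbb C)$ be a finite group generated by complex reflections (elements $s\ne 1$ fixing a hyperplane of $V=\mathbb C^n$ pointwise). Let $S=\mathbb C[x_1,\dots,x_n]$ be the ring of polynomial functions on $V$, on which $G$ acts by $(g f)(v)=f(g^{-1}v)$, and let $R=S^G$. Let $A$ be the set of reflecting hyperplanes of $G$; for $H\in A$ let $\alpha_H\in S$ be a linear form with kernel $H$, and let $e_H$ be the order of the subgroup of $G$ fixing $H$ pointwise. Put $$z=\prod_{H\in A}\alpha_H,\qquad \Delta=\prod_{H\in A}\alpha_H^{e_H},$$ and for a $G$-orbit $\mathfrak O\subset A$ put $$j_{\mathfrak O}=\prod_{H\in\mathfrak O}\alpha_H,\qquad \Delta_{\mathfrak O}=\prod_{H\in\mathfrak O}\alpha_H^{e_H}.$$ For a linear character $\chi:G\to\mathbb C^\times$ let $S^G_\chi=\{f\in S: g f=\chi(g)f \text{ for all } g\in G\}$ be its isotypical component, an $R$-submodule of $S$, and let $\det$ be the linear character of $G$ given by the determinant of the action of $g$ on the space of linear forms $\langle x_1,\dots,x_n\rangle\subset S$. Then for every orbit $\mathfrak O$ the polynomials $\Delta$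 and $\Delta_{\mathfrak O}$ lie in $R$, the $R$-modules $S/(z)$ and $R/(\Delta_{\mathfrak O})$ are annihilated by $\Delta$, and $R/(\Delta_{\mathfrak O})$ is (isomorphic to) a direct summand of $S/(z)$ as an $R/(\Delta)$-module. More precisely, there is a linear character $\theta_{\mathfrak O}$ of $G$ with $g(j_{\mathfrak O})=\theta_{\mathfrak O}(g)\,j_{\mathfrak O}$ for all $g\in G$, and, for every $H\in\mathfrak O$ and $\theta=\theta_{\mathfrak O}^{\,e_H-1}$, multiplication by $z$ maps $S^G_{\theta}$ into $S^G_{\theta\otimes\det}$, the cokernel of $z|_{\theta}:S^G_{\theta}\to S^G_{\theta\otimes\det}$ is annihilated by $\Delta$ and is isomorphic to $R/(\Delta_{\mathfrak O})$ as an $R/(\Delta)$-module, and the map $S^G_{\theta\otimes\det}/zS^G_{\theta}\to S/(z)$ induced by the inclusion $S^G_{\theta\otimes\det}\subset S$ is an isomorphism onto a direct summand of the $R/(\Delta)$-module $S/(z)$. -/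

import Mathlib

open scoped Matrix

noncomputable section

namespace ComplexReflection

/-- The polynomial ring `S = ℂ[x₁, …, xₙ]`, viewed as the ring of polynomial functions on
`V = ℂⁿ`. -/
abbrev PolyRing (n : ℕ) : Type := MvPolynomial (Fin n) ℂ

/-- The action of a linear automorphism `g` of `V = ℂⁿ` on `S`: it is the algebra map extending
the contragredient action on the linear forms, so that `(g • f)(v) = f (g⁻¹ v)`
(see `eval_act`). -/
def act {n : ℕ} (g : GL (Fin n) ℂ) : PolyRing n →ₐ[ℂ] PolyRing n :=
  MvPolynomial.aeval fun i =>
    ∑ j, MvPolynomial.C (((g⁻¹ : GL (Fin n) ℂ) : Matrix (Fin n) (Fin n) ℂ) i j) *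
      MvPolynomial.X j

theorem eval_act {n : ℕ} (g : GL (Fin n) ℂ) (f : PolyRing n) (v : Fin n → ℂ) :
    MvPolynomial.eval v (act g f) =
      MvPolynomial.eval (((g⁻¹ : GL (Fin n) ℂ) : Matrix (Fin n) (Fin n) ℂ) *ᵥ v) f := by
  induction f using MvPolynomial.induction_on with
  | C a => simp [act]
  | add p q hp hq => simp [hp, hq]
  | mul_X p i hp =>
    rw [map_mul, map_mul, hp, map_mul]
    simp [act, Matrix.mulVec, dotProduct]

/-- `g` fixes the subspace `H` of `V = ℂⁿ` pointwise. -/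
def FixesPointwise {n : ℕ} (g : GL (Fin n) ℂ) (H : Submodule ℂ (Fin n → ℂ)) : Prop :=
  ∀ v ∈ H, (g : Matrix (Fin n) (Fin n) ℂ) *ᵥ v = v

/-- A complex reflection: an automorphism of `V`, not the identity, that fixes a hyperplane
pointwise (hyperplanes are the maximal proper subspaces). For elements of finite order, the only
ones considered below, such a map is automatically diagonalisable. -/
def IsReflection {n : ℕ} (s : GL (Fin n) ℂ) : Prop :=
  s ≠ 1 ∧ ∃ H : Submodule ℂ (Fin n → ℂ), IsCoatom H ∧ FixesPointwise s H

/-- `G` is generated by the complex reflections it contains. -/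
def IsReflectionGroup {n : ℕ} (G : Subgroup (GL (Fin n) ℂ)) : Prop :=
  Subgroup.closure {s | s ∈ G ∧ IsReflection s} = G

/-- The set `A(G)` of reflecting hyperplanes of `G`. -/
def reflectingHyperplanes {n : ℕ} (G : Subgroup (GL (Fin n) ℂ)) :
    Set (Submodule ℂ (Fin n → ℂ)) :=
  {H | IsCoatom H ∧ ∃ s ∈ G, s ≠ 1 ∧ FixesPointwise s H}

/-- A finite group has finitely many reflecting hyperplanes, so that the products over them
below are genuine finite products. -/
theorem finite_reflectingHyperplanes {n : ℕ} (G : Subgroup (GL (Fin n) ℂ)) [Finite G] :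
    (reflectingHyperplanes G).Finite := by
  have key : ∀ (s : GL (Fin n) ℂ) (H : Submodule ℂ (Fin n → ℂ)), IsCoatom H → s ≠ 1 →
      FixesPointwise s H →
      H = LinearMap.ker (Matrix.mulVecLin ((s : Matrix (Fin n) (Fin n) ℂ) - 1)) := by
    intro s H hH hs hf
    have hle : H ≤ LinearMap.ker (Matrix.mulVecLin ((s : Matrix (Fin n) (Fin n) ℂ) - 1)) := by
      intro v hv
      simp [hf v hv]
    rcases hle.eq_or_lt with h | h
    · exact h
    · exfalso
      have h0 := LinearMap.ker_eq_top.mp (hH.2 _ h)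
      apply hs
      have h1 : (s : Matrix (Fin n) (Fin n) ℂ) - 1 = 0 :=
        Matrix.toLin'.injective (by rw [Matrix.toLin'_apply', h0, map_zero])
      exact Units.ext (sub_eq_zero.mp h1)
  refine (Set.finite_range (fun s : G => LinearMap.ker
    (Matrix.mulVecLin (((s : GL (Fin n) ℂ) : Matrix (Fin n) (Fin n) ℂ) - 1)))).subset ?_
  rintro H ⟨hH, s, hsG, hs, hf⟩
  exact ⟨⟨s, hsG⟩, (key s H hH hs hf).symm⟩

/-- The set `A(G)/G` of orbits of reflecting hyperplanes under `H ↦ gH`. -/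
def hyperplaneOrbits {n : ℕ} (G : Subgroup (GL (Fin n) ℂ)) :
    Set (Set (Submodule ℂ (Fin n → ℂ))) :=
  {O | ∃ H ∈ reflectingHyperplanes G,
    O = {K | ∃ g ∈ G, K = H.map (Matrix.mulVecLin (g : Matrix (Fin n) (Fin n) ℂ))}}

/-- The order `e_H` of the subgroup `G(H)` of `G` fixing `H` pointwise. -/
def fixerOrder {n : ℕ} (G : Subgroup (GL (Fin n) ℂ)) (H : Submodule ℂ (Fin n → ℂ)) : ℕ :=
  Nat.card {g : GL (Fin n) ℂ // g ∈ G ∧ FixesPointwise g H}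

/-- `f ∈ S` is a defining linear equation of `H`: a linear form with kernel `H`. -/
def IsDefiningForm {n : ℕ} (H : Submodule ℂ (Fin n → ℂ)) (f : PolyRing n) : Prop :=
  f.IsHomogeneous 1 ∧ ∀ v : Fin n → ℂ, v ∈ H ↔ MvPolynomial.eval v f = 0

/-- The invariant ring `R = S^G`. -/
def invariantRing {n : ℕ} (G : Subgroup (GL (Fin n) ℂ)) : Subring (PolyRing n) where
  carrier := {f | ∀ g ∈ G, act g f = f}
  mul_mem' := fun ha hb g hg => by rw [map_mul, ha g hg, hb g hg]
  add_mem' := fun ha hb g hg => by rw [map_add, ha g hg, hb g hg]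
  one_mem' := fun g _ => map_one (act g)
  zero_mem' := fun g _ => map_zero (act g)
  neg_mem' := fun ha g hg => by rw [map_neg, ha g hg]

/-- The quotient `S/I` as an `R`-module (a shortcut to the instance in Mathlib). -/
instance quotientModule {n : ℕ} (G : Subgroup (GL (Fin n) ℂ)) (I : Ideal (PolyRing n)) :
    Module (invariantRing G) (PolyRing n ⧸ I) :=
  Submodule.Quotient.module' I

/-- The isotypical component of `S` of a linear character `χ` of `G`, that is, its relative
invariants, as an `R`-submodule of `S`. -/
def isotypic {n : ℕ} (G : Subgroup (GL (Fin n) ℂ)) (χ : G →* ℂˣ) :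
    Submodule (invariantRing G) (PolyRing n) where
  carrier := {f | ∀ g : G, act (g : GL (Fin n) ℂ) f = MvPolynomial.C (χ g : ℂ) * f}
  add_mem' := fun ha hb g => by rw [map_add, ha g, hb g, mul_add]
  zero_mem' := fun g => by rw [map_zero, mul_zero]
  smul_mem' := fun r f hf g => by
    rw [Algebra.smul_def, map_mul, hf g]
    have hr : act (g : GL (Fin n) ℂ) (algebraMap (invariantRing G) (PolyRing n) r) =
        algebraMap (invariantRing G) (PolyRing n) r := r.2 g g.2
    rw [hr]
    ring

/-- The linear character of `G` given by the determinant of the action on the space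
`V* = ⟨x₁, …, xₙ⟩` of linear forms in `S`; as `g` acts there contragrediently, this is
`g ↦ (det g)⁻¹`. -/
def detChar {n : ℕ} (G : Subgroup (GL (Fin n) ℂ)) : G →* ℂˣ :=
  (Matrix.GeneralLinearGroup.det.comp G.subtype)⁻¹

/-- `M` is (isomorphic to) a direct summand of `N` as an `A`-module. -/
def IsDirectSummand (A M N : Type*) [Ring A] [AddCommGroup M] [Module A M]
    [AddCommGroup N] [Module A N] : Prop :=
  ∃ P Q : Submodule A N, IsCompl P Q ∧ Nonempty (M ≃ₗ[A] P)

/-- Multiplication by `z`, restricted to a map from the isotypical component of `χ` to that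
of `ψ`. -/
def mulRestrict {n : ℕ} (G : Subgroup (GL (Fin n) ℂ)) (z : PolyRing n) (χ ψ : G →* ℂˣ)
    (hz : ∀ f ∈ isotypic G χ, z * f ∈ isotypic G ψ) :
    isotypic G χ →ₗ[invariantRing G] isotypic G ψ :=
  (LinearMap.mulLeft (invariantRing G) z).restrict hz

/-- The cokernel of `z|_χ : S_χ → S_ψ`. -/
abbrev CokerMul {n : ℕ} (G : Subgroup (GL (Fin n) ℂ)) (z : PolyRing n) (χ ψ : G →* ℂˣ)
    (hz : ∀ f ∈ isotypic G χ, z * f ∈ isotypic G ψ) : Type :=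
  isotypic G ψ ⧸ LinearMap.range (mulRestrict G z χ ψ hz)

end ComplexReflection

end

open ComplexReflection

/-!
Let `χ` be a linear character of `G` and let `0 ≤ a_H < e_H` be such that `χ` and `det ^ a_H` agree
on the pointwise fixer of `H`, for every reflecting hyperplane `H`. A relative invariant of `χ`
is divisible by every `α_H ^ a_H`, so that `S_χ` is the free `R`-module on `∏ α_H ^ a_H` (Stanley).
Multiplication by `z` raises all exponents by one. Let `e` be the common value of `e_H` on the orbit
`O`. For `χ = θ ^ (e - 1)` the exponents are `e - 1` on `O` and `0` elsewhere; for `χ det` they are,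
modulo the `e_H`, `0` on `O` and `1` elsewhere, so that `z` carries the generator of `S_χ` to `Δ_O`
times that of `S_{χ det}`. The cokernel is therefore `R/(Δ_O)`, and it is a direct summand of
`S/(z)` because multiplication by `z` intertwines the Reynolds operators of `χ` and `χ det`.
-/

namespace ComplexReflection

section Modules

variable {A M N : Type*}

theorem nonempty_quotient_range_equiv [CommRing A] [AddCommGroup M] [Module A M] [AddCommGroup N]
    [Module A N] (f : M →ₗ[A] N) (eM : A ≃ₗ[A] M) (eN : A ≃ₗ[A] N) {d : A}
    (h : f (eM 1) = eN d) : Nonempty ((N ⧸ LinearMap.range f) ≃ₗ[A] A ⧸ Ideal.span {d}) := by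
  have hrange : Submodule.map eN.toLinearMap (Ideal.span {d}) = LinearMap.range f := by
    rw [← eM.range_comp f, ← Submodule.map_top, ← Ideal.span_singleton_one, Ideal.span, Ideal.span,
      Submodule.map_span, Submodule.map_span, Set.image_singleton, Set.image_singleton]
    exact congrArg (fun x => Submodule.span A {x}) h.symm
  exact ⟨(Submodule.Quotient.equiv _ _ eN hrange).symm⟩

theorem exists_isCompl_of_leftInverse [Ring A] [AddCommGroup M] [Module A M] [AddCommGroup N]
    [Module A N] (i : M →ₗ[A] N) (r : N →ₗ[A] M) (h : Function.LeftInverse r i) :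
    ∃ (P Q : Submodule A N) (φ : M ≃ₗ[A] P), IsCompl P Q ∧ ∀ x, (φ x : N) = i x := by
  refine ⟨LinearMap.range i, LinearMap.ker (i.rangeRestrict ∘ₗ r),
    LinearEquiv.ofInjective i h.injective, LinearMap.isCompl_of_proj ?_, fun _ => rfl⟩
  rintro ⟨_, x, rfl⟩
  exact Subtype.ext (congrArg i (h x))

variable [CommRing A] {I : Ideal A} [AddCommGroup M] [Module A M] [AddCommGroup N] [Module A N]

theorem nonempty_linearEquiv_quotient (hM : Module.IsTorsionBySet A M I)
    (hN : Module.IsTorsionBySet A N I) (e : M ≃ₗ[A] N) :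
    letI := hM.module
    letI := hN.module
    Nonempty (M ≃ₗ[A ⧸ I] N) := by
  let _ := hM.module
  let _ := hN.module
  have := hM.isScalarTower (S := A)
  have := hN.isScalarTower (S := A)
  exact ⟨e.extendScalarsOfSurjective Ideal.Quotient.mk_surjective⟩

theorem exists_isCompl_quotient_of_leftInverse (hM : Module.IsTorsionBySet A M I)
    (hN : Module.IsTorsionBySet A N I) (i : M →ₗ[A] N) (r : N →ₗ[A] M)
    (h : Function.LeftInverse r i) :
    letI := hM.module
    letI := hN.module
    ∃ (P Q : Submodule (A ⧸ I) N) (φ : M ≃ₗ[A ⧸ I] P), IsCompl P Q ∧ ∀ x, (φ x : N) = i x := by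
  let _ := hM.module
  let _ := hN.module
  have := hM.isScalarTower (S := A)
  have := hN.isScalarTower (S := A)
  exact exists_isCompl_of_leftInverse
    (i.extendScalarsOfSurjective (Ideal.Quotient.mk_surjective (I := I)))
    (r.extendScalarsOfSurjective (Ideal.Quotient.mk_surjective (I := I))) h

theorem isTorsionBySet_span_quotient_span {B : Type*} [CommRing B] [Algebra A B] {b : B} {d : A}
    (hd : b ∣ algebraMap A B d) :
    Module.IsTorsionBySet A (B ⧸ Ideal.span {b}) (Ideal.span {d} : Ideal A) := by
  refine (Module.isTorsionBySet_span_singleton_iff d).mpr fun x => ?_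
  obtain ⟨f, rfl⟩ := Ideal.Quotient.mk_surjective x
  rw [Algebra.smul_def, ← Ideal.Quotient.mk_algebraMap, ← map_mul,
    Ideal.Quotient.eq_zero_iff_dvd]
  exact hd.mul_right f

end Modules

open MvPolynomial

variable {n : ℕ} {G : Subgroup (GL (Fin n) ℂ)} {H K : Submodule ℂ (Fin n → ℂ)}
  {a b f : PolyRing n} {g s t : GL (Fin n) ℂ} {v w : Fin n → ℂ}

section Action

theorem inv_mulVec_mulVec (g : GL (Fin n) ℂ) (v : Fin n → ℂ) : g⁻¹.1 *ᵥ (g.1 *ᵥ v) = v := by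
  rw [Matrix.mulVec_mulVec, ← Units.val_mul, inv_mul_cancel, Units.val_one, Matrix.one_mulVec]

theorem mulVec_inv_mulVec (g : GL (Fin n) ℂ) (v : Fin n → ℂ) : g.1 *ᵥ (g⁻¹.1 *ᵥ v) = v := by
  simpa only [inv_inv] using inv_mulVec_mulVec g⁻¹ v

theorem act_mul (g h : GL (Fin n) ℂ) (f : PolyRing n) : act (g * h) f = act g (act h f) :=
  MvPolynomial.funext fun v => by simp [eval_act, Matrix.mulVec_mulVec]

theorem act_C (g : GL (Fin n) ℂ) (c : ℂ) : act g (C c) = C c :=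
  (act g).commutes c

theorem isHomogeneous_one_act (g : GL (Fin n) ℂ) (hf : f.IsHomogeneous 1) :
    (act g f).IsHomogeneous 1 := by
  have hX : ∀ i, (∑ j, C (g⁻¹.1 i j) * X j : PolyRing n).IsHomogeneous 1 := fun i =>
    IsHomogeneous.sum _ _ 1 fun j _ => isHomogeneous_C_mul_X (g⁻¹.1 i j) j
  exact one_mul 1 ▸ hf.aeval _ hX

/-- The action `g • H = gH` of `GL(V)` on the subspaces of `V`, encoded by the same `Submodule.map`
as `hyperplaneOrbits`. -/
instance : MulAction (GL (Fin n) ℂ) (Submodule ℂ (Fin n → ℂ)) where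
  smul g H := H.map (Matrix.mulVecLin g.1)
  one_smul H := (congrArg H.map Matrix.mulVecLin_one).trans H.map_id
  mul_smul g h H := (congrArg H.map (Matrix.mulVecLin_mul g.1 h.1)).trans (H.map_comp _ _)

theorem mem_smul_iff : v ∈ g • H ↔ g⁻¹.1 *ᵥ v ∈ H :=
  ⟨fun ⟨u, hu, huv⟩ => by rwa [← huv, Matrix.mulVecLin_apply, inv_mulVec_mulVec],
    fun h => ⟨_, h, mulVec_inv_mulVec g v⟩⟩

theorem isCoatom_smul (g : GL (Fin n) ℂ) (hH : IsCoatom H) : IsCoatom (g • H) :=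
  (((MulAction.toPerm g).toOrderIso (fun _ _ => Submodule.map_mono)
    fun _ _ => Submodule.map_mono).isCoatom_iff H).mpr hH

end Action

section FixesPointwise

theorem FixesPointwise.one : FixesPointwise (1 : GL (Fin n) ℂ) H := fun v _ => by simp

theorem FixesPointwise.mul (hs : FixesPointwise s H) (ht : FixesPointwise t H) :
    FixesPointwise (s * t) H := fun v hv => by
  rw [Units.val_mul, ← Matrix.mulVec_mulVec, ht v hv, hs v hv]

theorem FixesPointwise.inv (hs : FixesPointwise s H) : FixesPointwise s⁻¹ H := fun v hv => by
  nth_rewrite 1 [← hs v hv]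
  exact inv_mulVec_mulVec s v

theorem FixesPointwise.conj (hs : FixesPointwise s H) (g : GL (Fin n) ℂ) :
    FixesPointwise (g * s * g⁻¹) (g • H) := fun v hv => by
  rw [Units.val_mul, Units.val_mul, ← Matrix.mulVec_mulVec, ← Matrix.mulVec_mulVec,
    hs _ (mem_smul_iff.mp hv), mulVec_inv_mulVec]

theorem FixesPointwise.eval_act (hs : FixesPointwise s H) (hv : v ∈ H) (f : PolyRing n) :
    eval v (act s f) = eval v f := by
  rw [ComplexReflection.eval_act, hs.inv v hv]

theorem FixesPointwise.toLin'_eq_transvection (hs : FixesPointwise s H)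
    {l : Module.Dual ℂ (Fin n → ℂ)} (hl : LinearMap.ker l ≤ H) (hw : l w = 1) :
    Matrix.toLin' s.1 = LinearMap.transvection l (s.1 *ᵥ w - w) := by
  refine LinearMap.ext fun v => ?_
  have hv : s.1 *ᵥ (v - l v • w) = v - l v • w := hs _ (hl (by simp [hw]))
  rw [Matrix.mulVec_sub, Matrix.mulVec_smul, sub_eq_iff_eq_add] at hv
  rw [Matrix.toLin'_apply, LinearMap.transvection.apply, hv]
  module

theorem FixesPointwise.det_eq (hs : FixesPointwise s H) {l : Module.Dual ℂ (Fin n → ℂ)}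
    (hl : LinearMap.ker l ≤ H) (hw : l w = 1) : s.1.det = l (s.1 *ᵥ w) := by
  rw [← LinearMap.det_toLin', hs.toLin'_eq_transvection hl hw, LinearMap.transvection.det, map_sub,
    hw, add_sub_cancel]

/-- `s w = w + u` with `u` in the hyperplane, so that `sᵏ w = w + k u`. -/
theorem FixesPointwise.eq_one_of_det_eq_one (hs : FixesPointwise s H) (hfin : IsOfFinOrder s)
    {l : Module.Dual ℂ (Fin n → ℂ)} (hl : LinearMap.ker l = H) (hw : l w = 1)
    (hdet : s.1.det = 1) : s = 1 := by
  obtain ⟨u, hu⟩ : ∃ u, u = s.1 *ᵥ w - w := ⟨_, rfl⟩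
  have hsw : s.1 *ᵥ w = w + u := by rw [hu, add_sub_cancel]
  have hsu : s.1 *ᵥ u = u := hs u <| hl ▸ by
    rw [LinearMap.mem_ker, hu, map_sub, ← hs.det_eq hl.le hw, hdet, hw, sub_self]
  have hpow : ∀ k : ℕ, (s ^ k).1 *ᵥ w = w + (k : ℂ) • u := fun k => by
    induction k with
    | zero => simp
    | succ k ih =>
      rw [pow_succ', Units.val_mul, ← Matrix.mulVec_mulVec, ih, Matrix.mulVec_add,
        Matrix.mulVec_smul, hsw, hsu]
      push_cast
      module
  obtain ⟨m, hm, hsm⟩ := isOfFinOrder_iff_pow_eq_one.mp hfin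
  have hu0 : u = 0 := by simpa [hsm, hm.ne'] using hpow m
  refine Units.ext (Matrix.toLin'.injective ?_)
  rw [hs.toLin'_eq_transvection hl.le hw, ← hu, hu0, LinearMap.transvection.of_right_eq_zero,
    Units.val_one, Matrix.toLin'_one]

end FixesPointwise

section DefiningForm

theorem exists_dual_of_isHomogeneous_one (hf : f.IsHomogeneous 1) :
    ∃ l : Module.Dual ℂ (Fin n → ℂ), ∀ v, eval v f = l v := by
  rw [← mem_homogeneousSubmodule, homogeneousSubmodule_one_eq_span_X] at hf
  obtain ⟨c, rfl⟩ := (Submodule.mem_span_range_iff_exists_fun ℂ).mp hf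
  exact ⟨∑ i, c i • LinearMap.proj i, fun v => by simp [smul_eval]⟩

theorem IsDefiningForm.exists_dual (hH : IsCoatom H) (ha : IsDefiningForm H a) :
    ∃ (l : Module.Dual ℂ (Fin n → ℂ)) (w : Fin n → ℂ),
      (∀ v, eval v a = l v) ∧ LinearMap.ker l = H ∧ l w = 1 := by
  obtain ⟨l, hl⟩ := exists_dual_of_isHomogeneous_one ha.1
  have hker : LinearMap.ker l = H := Submodule.ext fun v => by rw [ha.2, hl, LinearMap.mem_ker]
  have hl0 : l ≠ 0 := by
    rintro rfl
    exact hH.1 (hker ▸ LinearMap.ker_zero)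
  obtain ⟨w, hw⟩ := LinearMap.surjective_of_ne_zero hl0 1
  exact ⟨l, w, hl, hker, hw⟩

theorem IsDefiningForm.ne_zero (hH : IsCoatom H) (ha : IsDefiningForm H a) : a ≠ 0 := by
  rintro rfl
  exact hH.1 (eq_top_iff.mpr fun v _ => (ha.2 v).mpr (map_zero _))

theorem IsDefiningForm.smul (ha : IsDefiningForm H a) (g : GL (Fin n) ℂ) :
    IsDefiningForm (g • H) (act g a) :=
  ⟨isHomogeneous_one_act g ha.1, fun v => by rw [mem_smul_iff, ha.2, eval_act]⟩

theorem IsDefiningForm.act_eq (hH : IsCoatom H) (ha : IsDefiningForm H a)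
    (hs : FixesPointwise s H) : act s a = C (s⁻¹.1.det) * a := by
  obtain ⟨l, w, hl, hker, hw⟩ := ha.exists_dual hH
  refine MvPolynomial.funext fun v => ?_
  rw [eval_act, map_mul, eval_C, hl, hl, ← Matrix.toLin'_apply,
    hs.inv.toLin'_eq_transvection hker.le hw, LinearMap.transvection.apply, map_add, map_smul,
    map_sub, hw, ← hs.inv.det_eq hker.le hw, smul_eq_mul]
  ring

/-- The endomorphism `f ↦ f(v - a(v) w)` of `S`; for a linear form `a` with `a(w) = 1` it is the
restriction of functions to the hyperplane `a = 0` along the projection parallel to `w`. -/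
noncomputable def restrictAlong (a : PolyRing n) (w : Fin n → ℂ) : PolyRing n →ₐ[ℂ] PolyRing n :=
  aeval fun i => X i - C (w i) * a

theorem eval_restrictAlong (a : PolyRing n) (w v : Fin n → ℂ) (f : PolyRing n) :
    eval v (restrictAlong a w f) = eval (v - eval v a • w) f := by
  induction f using MvPolynomial.induction_on with
  | C c => simp [restrictAlong]
  | add p q hp hq => simp only [map_add, hp, hq]
  | mul_X p i hp =>
    rw [map_mul, map_mul, hp, map_mul]
    simp [restrictAlong, mul_comm]

theorem dvd_sub_restrictAlong (a : PolyRing n) (w : Fin n → ℂ) (f : PolyRing n) :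
    a ∣ f - restrictAlong a w f := by
  have hmk : (Ideal.Quotient.mkₐ ℂ (Ideal.span {a})).comp (restrictAlong a w) =
      Ideal.Quotient.mkₐ ℂ (Ideal.span {a}) := algHom_ext fun i => by
    rw [AlgHom.comp_apply, restrictAlong, aeval_X, Ideal.Quotient.mkₐ_eq_mk,
      Ideal.Quotient.mk_eq_mk_iff_sub_mem, sub_sub_cancel_left, neg_mem_iff]
    exact Ideal.mul_mem_left _ _ (Ideal.mem_span_singleton_self a)
  rw [← Ideal.mem_span_singleton, ← Ideal.Quotient.mk_eq_mk_iff_sub_mem]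
  exact (DFunLike.congr_fun hmk f).symm

theorem IsDefiningForm.exists_algHom_dvd_iff (hH : IsCoatom H) (ha : IsDefiningForm H a) :
    ∃ r : PolyRing n →ₐ[ℂ] PolyRing n, ∀ f,
      (a ∣ f ↔ r f = 0) ∧ (a ∣ f ↔ ∀ v ∈ H, eval v f = 0) := by
  obtain ⟨l, w, hl, hker, hw⟩ := ha.exists_dual hH
  have hvanish : ∀ f, a ∣ f → ∀ v ∈ H, eval v f = 0 := by
    rintro _ ⟨q, rfl⟩ v hv
    rw [map_mul, (ha.2 v).mp hv, zero_mul]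
  have hrestrict : ∀ f, (∀ v ∈ H, eval v f = 0) → restrictAlong a w f = 0 := fun f hf =>
    MvPolynomial.funext fun v => by
      rw [eval_restrictAlong, map_zero]
      exact hf _ (hker ▸ by simp [hl, hw])
  have hdvd : ∀ f, restrictAlong a w f = 0 → a ∣ f := fun f hf => by
    simpa only [hf, sub_zero] using dvd_sub_restrictAlong a w f
  exact ⟨restrictAlong a w, fun f =>
    ⟨⟨fun h => hrestrict f (hvanish f h), hdvd f⟩, hvanish f, fun h => hdvd f (hrestrict f h)⟩⟩

theorem IsDefiningForm.dvd_iff (hH : IsCoatom H) (ha : IsDefiningForm H a) :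
    a ∣ f ↔ ∀ v ∈ H, eval v f = 0 := by
  obtain ⟨r, hr⟩ := ha.exists_algHom_dvd_iff hH
  exact (hr f).2

theorem IsDefiningForm.prime (hH : IsCoatom H) (ha : IsDefiningForm H a) : Prime a := by
  obtain ⟨r, hr⟩ := ha.exists_algHom_dvd_iff hH
  have hker : Ideal.span {a} = RingHom.ker r := Ideal.ext fun f => by
    rw [Ideal.mem_span_singleton, (hr f).1, RingHom.mem_ker]
  rw [← Ideal.span_singleton_prime (ha.ne_zero hH), hker]
  exact RingHom.ker_isPrime r

theorem IsDefiningForm.dvd_iff_eq (hH : IsCoatom H) (hK : IsCoatom K) (ha : IsDefiningForm H a)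
    (hb : IsDefiningForm K b) : a ∣ b ↔ H = K := by
  have hle : a ∣ b ↔ H ≤ K := by
    simp only [ha.dvd_iff hH, ← hb.2, SetLike.le_def]
  rw [hle, hH.le_iff_eq hK.1, eq_comm]

theorem IsDefiningForm.associated (hH : IsCoatom H) (ha : IsDefiningForm H a)
    (hb : IsDefiningForm H b) : Associated a b :=
  associated_of_dvd_dvd ((ha.dvd_iff_eq hH hH hb).mpr rfl) ((hb.dvd_iff_eq hH hH ha).mpr rfl)

end DefiningForm

section Fixer

variable (G H) in
/-- The pointwise fixer `G(H)` of `H`, as a subgroup of `G`. -/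
def fixer : Subgroup G where
  carrier := {s | FixesPointwise s.1 H}
  one_mem' := .one
  mul_mem' := .mul
  inv_mem' := .inv

variable (G H) in
theorem card_fixer : Nat.card (fixer G H) = fixerOrder G H :=
  Nat.card_congr (Equiv.subtypeSubtypeEquivSubtypeInter (· ∈ G) (FixesPointwise · H))

theorem fixer_smul (g : G) (H : Submodule ℂ (Fin n → ℂ)) :
    fixer G (g • H) = (fixer G H).map (MulAut.conj g).toMonoidHom := by
  refine Subgroup.ext fun s => ⟨fun hs => ⟨g⁻¹ * s * g, ?_, by simp [mul_assoc]⟩, ?_⟩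
  · have h := FixesPointwise.conj (H := g.1 • H) hs g.1⁻¹
    rwa [inv_inv, inv_smul_smul] at h
  · rintro ⟨t, ht, rfl⟩
    exact FixesPointwise.conj ht g.1

theorem fixerOrder_smul (g : G) (H : Submodule ℂ (Fin n → ℂ)) :
    fixerOrder G (g • H) = fixerOrder G H := by
  rw [← card_fixer, ← card_fixer, fixer_smul]
  exact Subgroup.card_map_of_injective (MulAut.conj g).injective

theorem mem_reflectingHyperplanes_iff :
    H ∈ reflectingHyperplanes G ↔ IsCoatom H ∧ fixer G H ≠ ⊥ := by
  rw [Subgroup.ne_bot_iff_exists_ne_one]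
  exact and_congr_right fun _ => ⟨fun ⟨s, hsG, hs, hsH⟩ =>
      ⟨⟨⟨s, hsG⟩, hsH⟩, fun h => hs (congrArg (fun t => t.1.1) h)⟩,
    fun ⟨s, hs⟩ => ⟨s, s.1.2, by simpa using hs, s.2⟩⟩

theorem smul_mem_reflectingHyperplanes (g : G) (hH : H ∈ reflectingHyperplanes G) :
    g • H ∈ reflectingHyperplanes G := by
  rw [mem_reflectingHyperplanes_iff] at hH ⊢
  refine ⟨isCoatom_smul g.1 hH.1, ?_⟩
  rw [fixer_smul, Ne, Subgroup.map_eq_bot_iff_of_injective _ (MulAut.conj g).injective]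
  exact hH.2

theorem detChar_pow_fixerOrder {s : G} (hs : s ∈ fixer G H) :
    detChar G s ^ fixerOrder G H = 1 := by
  rw [← map_pow, ← card_fixer, orderOf_dvd_iff_pow_eq_one.mp (Subgroup.orderOf_dvd_natCard _ hs),
    map_one]

theorem IsDefiningForm.act_eq_detChar (hH : IsCoatom H) (ha : IsDefiningForm H a) {s : G}
    (hs : s ∈ fixer G H) : act s.1 a = C (detChar G s : ℂ) * a :=
  ha.act_eq hH hs

variable [Finite G]

theorem one_lt_fixerOrder (hH : H ∈ reflectingHyperplanes G) : 1 < fixerOrder G H := by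
  rw [← card_fixer, Subgroup.one_lt_card_iff_ne_bot]
  exact (mem_reflectingHyperplanes_iff.mp hH).2

theorem isOfFinOrder_coe (s : G) : IsOfFinOrder s.1 :=
  G.subtype.isOfFinOrder (isOfFinOrder_of_finite s)

theorem eq_one_of_detChar_eq_one (hH : IsCoatom H) {s : G} (hs : s ∈ fixer G H)
    (hdet : detChar G s = 1) : s = 1 := by
  obtain ⟨l, hl0, hl⟩ := Submodule.exists_le_ker_of_lt_top H hH.lt_top
  have hker : LinearMap.ker l = H :=
    (hH.le_iff.mp hl).resolve_left (mt LinearMap.ker_eq_top.mp hl0)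
  obtain ⟨w, hw⟩ := LinearMap.surjective_of_ne_zero hl0 1
  have hdet' : s.1.1.det = 1 := congrArg Units.val (inv_eq_one.mp hdet)
  exact Subtype.ext (FixesPointwise.eq_one_of_det_eq_one hs (isOfFinOrder_coe s) hker hw hdet')

theorem injOn_detChar_fixer (hH : IsCoatom H) : Set.InjOn (detChar G) (fixer G H) :=
  fun s hs t ht hst => mul_inv_eq_one.mp <| eq_one_of_detChar_eq_one hH
    ((fixer G H).mul_mem hs ((fixer G H).inv_mem ht))
    (by rw [map_mul, map_inv, hst, mul_inv_cancel])

theorem exists_detChar_pow_ne_one (hH : IsCoatom H) {k : ℕ} (hk : k ≠ 0)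
    (hkH : k < fixerOrder G H) : ∃ s ∈ fixer G H, detChar G s ^ k ≠ 1 := by
  by_contra! h
  have : NeZero k := ⟨hk⟩
  let d : fixer G H → rootsOfUnity k ℂ := fun s =>
    ⟨detChar G s, (mem_rootsOfUnity _ _).mpr (h s s.2)⟩
  have hd : Function.Injective d := fun s t hst =>
    Subtype.ext (injOn_detChar_fixer hH s.2 t.2 (congrArg Subtype.val hst))
  have hle := (Nat.card_le_card_of_injective d hd).trans (card_rootsOfUnity ℂ k)
  rw [card_fixer] at hle
  exact hle.not_gt hkH

end Fixer

section Isotypic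

variable {χ ψ : G →* ℂˣ}

theorem mem_isotypic_one : f ∈ isotypic G 1 ↔ f ∈ invariantRing G := by
  refine Subtype.forall.trans (forall₂_congr fun g hg => ?_)
  rw [MonoidHom.one_apply, Units.val_one, C_1, one_mul]

theorem mul_mem_isotypic (ha : a ∈ isotypic G χ) (hb : b ∈ isotypic G ψ) :
    a * b ∈ isotypic G (χ * ψ) := fun g => by
  rw [map_mul, ha g, hb g, MonoidHom.mul_apply, Units.val_mul, C_mul]
  ring

theorem mem_invariantRing_of_mul_mem_isotypic (ha0 : a ≠ 0) (ha : a ∈ isotypic G χ)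
    (hab : a * b ∈ isotypic G χ) : b ∈ invariantRing G := fun g hg => by
  have h := hab ⟨g, hg⟩
  rw [map_mul, ha ⟨g, hg⟩, mul_assoc] at h
  have hC : (C (χ ⟨g, hg⟩ : ℂ) : PolyRing n) ≠ 0 := by simp
  exact mul_left_cancel₀ ha0 (mul_left_cancel₀ hC h)

theorem exists_mem_isotypic (hf0 : f ≠ 0) (hf : ∀ g : G, Associated f (act g.1 f)) :
    ∃ χ : G →* ℂˣ, f ∈ isotypic G χ := by
  have hunit : ∀ g : G, ∃ c : ℂˣ, act g.1 f = C (c : ℂ) * f := fun g => by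
    obtain ⟨u, hu⟩ := hf g
    obtain ⟨c, hc, huc⟩ := isUnit_iff_eq_C_of_isReduced.mp u.isUnit
    exact ⟨hc.unit, by rw [← hu, huc, mul_comm, IsUnit.unit_spec]⟩
  choose c hc using hunit
  refine ⟨MonoidHom.mk' c fun g h => ?_, hc⟩
  have hgh : (C (c (g * h) : ℂ) : PolyRing n) * f = C (c g * c h : ℂ) * f := by
    rw [← hc, Subgroup.coe_mul, act_mul, hc, map_mul, act_C, hc, C_mul]
    ring
  exact Units.ext (C_injective _ _ (mul_right_cancel₀ hf0 hgh))

theorem eq_detChar_pow_of_mem_isotypic (hH : IsCoatom H) (ha : IsDefiningForm H a) {k : ℕ}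
    (hf : a ^ k * f ∈ isotypic G χ) (hdvd : ¬ a ∣ f) {s : G} (hs : s ∈ fixer G H) :
    χ s = detChar G s ^ k := by
  rw [ha.dvd_iff hH] at hdvd
  push Not at hdvd
  obtain ⟨v, hv, hfv⟩ := hdvd
  have hact : a ^ k * (C (detChar G s ^ k : ℂ) * act s.1 f) = a ^ k * (C (χ s : ℂ) * f) := by
    have h := hf s
    rw [map_mul, map_pow, ha.act_eq_detChar hH hs] at h
    rw [C_pow]
    linear_combination h
  have heval := congrArg (eval v) (mul_left_cancel₀ (pow_ne_zero k (ha.ne_zero hH)) hact)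
  rw [map_mul, map_mul, FixesPointwise.eval_act hs hv, eval_C, eval_C] at heval
  exact Units.ext (by simpa using (mul_right_cancel₀ hfv heval).symm)

theorem IsReflectionGroup.monoidHom_ext (hG : IsReflectionGroup G) {A : Type*} [Group A]
    {χ ψ : G →* A} (h : ∀ H ∈ reflectingHyperplanes G, ∀ s ∈ fixer G H, χ s = ψ s) : χ = ψ := by
  have hle : G ≤ (MonoidHom.eqLocus χ ψ).map G.subtype := by
    conv_lhs => rw [← hG]
    rw [Subgroup.closure_le]
    rintro s ⟨hsG, hs, H, hH, hsH⟩
    exact ⟨⟨s, hsG⟩, h H ⟨hH, s, hsG, hs, hsH⟩ _ hsH, rfl⟩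
  refine MonoidHom.ext fun g => ?_
  obtain ⟨g', hg', hgg'⟩ := hle g.2
  rwa [← Subtype.ext hgg']

end Isotypic

section FormMonomial

variable {α : Submodule ℂ (Fin n → ℂ) → PolyRing n} {c d : Submodule ℂ (Fin n → ℂ) → ℕ}

/-- The monomial `∏ α_H ^ c_H` in the forms `α_H` of the reflecting hyperplanes. For infinitely many
factors `≠ 1` it has the junk value `1` of `finprod`. -/
noncomputable def formMonomial (G : Subgroup (GL (Fin n) ℂ))
    (α : Submodule ℂ (Fin n → ℂ) → PolyRing n) (c : Submodule ℂ (Fin n → ℂ) → ℕ) : PolyRing n :=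
  ∏ᶠ H ∈ reflectingHyperplanes G, α H ^ c H

theorem formMonomial_indicator {T : Set (Submodule ℂ (Fin n → ℂ))}
    (hT : T ⊆ reflectingHyperplanes G) :
    formMonomial G α (T.indicator c) = ∏ᶠ H ∈ T, α H ^ c H := by
  rw [formMonomial, ← Set.inter_eq_self_of_subset_right hT]
  refine finprod_congr fun H => ?_
  by_cases hH : H ∈ T
  · simp [hH, hT hH]
  · simp [hH]

variable [Finite G]

theorem formMonomial_eq_prod :
    formMonomial G α c = ∏ H ∈ (finite_reflectingHyperplanes G).toFinset, α H ^ c H :=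
  finprod_mem_eq_finite_toFinset_prod _ _

theorem formMonomial_mul :
    formMonomial G α c * formMonomial G α d = formMonomial G α (c + d) := by
  simp only [formMonomial_eq_prod, ← Finset.prod_mul_distrib, Pi.add_apply, pow_add]

theorem formMonomial_dvd_formMonomial (h : ∀ H ∈ reflectingHyperplanes G, c H ≤ d H) :
    formMonomial G α c ∣ formMonomial G α d := by
  simp only [formMonomial_eq_prod]
  exact Finset.prod_dvd_prod_of_dvd _ _ fun H hH => pow_dvd_pow _ (h H (by simpa using hH))

theorem formMonomial_eq_pow_mul (hH : H ∈ reflectingHyperplanes G) :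
    formMonomial G α c = α H ^ c H * formMonomial G α (({H}ᶜ : Set _).indicator c) := by
  conv_lhs => rw [← Set.indicator_self_add_compl {H} c, ← formMonomial_mul,
    formMonomial_indicator (Set.singleton_subset_iff.mpr hH), finprod_mem_singleton]

variable (hα : ∀ H ∈ reflectingHyperplanes G, IsDefiningForm H (α H))
include hα

theorem formMonomial_ne_zero : formMonomial G α c ≠ 0 := by
  rw [formMonomial_eq_prod, Finset.prod_ne_zero_iff]
  intro H hH
  rw [Set.Finite.mem_toFinset] at hH
  exact pow_ne_zero _ ((hα H hH).ne_zero hH.1)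

theorem not_dvd_formMonomial (hH : H ∈ reflectingHyperplanes G) (hc : c H = 0) :
    ¬ α H ∣ formMonomial G α c := by
  have hprime := (hα H hH).prime hH.1
  rw [formMonomial_eq_prod, hprime.dvd_finsetProd_iff]
  rintro ⟨K, hK, hdvd⟩
  rw [Set.Finite.mem_toFinset] at hK
  obtain rfl : H = K :=
    ((hα H hH).dvd_iff_eq hH.1 hK.1 (hα K hK)).mp (hprime.dvd_of_dvd_pow hdvd)
  rw [hc, pow_zero] at hdvd
  exact hprime.not_dvd_one hdvd

theorem formMonomial_dvd (h : ∀ H ∈ reflectingHyperplanes G, α H ^ c H ∣ f) :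
    formMonomial G α c ∣ f := by
  rw [formMonomial_eq_prod]
  refine Finset.prod_dvd_of_isRelPrime (fun H hH K hK hHK => .pow ?_) fun H hH => ?_
  · rw [Finset.mem_coe, Set.Finite.mem_toFinset] at hH hK
    change IsRelPrime (α H) (α K)
    rw [((hα H hH).prime hH.1).irreducible.isRelPrime_iff_not_dvd,
      (hα H hH).dvd_iff_eq hH.1 hK.1 (hα K hK)]
    exact hHK
  · exact h H (by simpa using hH)

theorem associated_act_formMonomial {g : G} (hc : ∀ H, c (g • H) = c H) :
    Associated (formMonomial G α c) (act g.1 (formMonomial G α c)) := by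
  have hstable : ∀ H, H ∈ reflectingHyperplanes G ↔ g • H ∈ reflectingHyperplanes G := fun H =>
    ⟨smul_mem_reflectingHyperplanes g, fun h => by
      simpa only [inv_smul_smul] using smul_mem_reflectingHyperplanes g⁻¹ h⟩
  have hreindex : formMonomial G α c =
      ∏ H ∈ (finite_reflectingHyperplanes G).toFinset, α (g • H) ^ c H := by
    rw [formMonomial_eq_prod]
    refine (Finset.prod_equiv (MulAction.toPerm g) (fun H => ?_) fun H _ => ?_).symm
    · simpa using hstable H
    · rw [MulAction.toPerm_apply, hc]
  nth_rewrite 1 [hreindex]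
  rw [formMonomial_eq_prod, map_prod]
  refine Associated.prod _ _ _ fun H hH => ?_
  rw [Set.Finite.mem_toFinset] at hH
  rw [map_pow]
  exact ((hα _ ((hstable H).mp hH)).associated (isCoatom_smul g.1 hH.1)
    ((hα H hH).smul g.1)).pow_pow

end FormMonomial

section Exponents

variable {χ ψ : G →* ℂˣ} {α : Submodule ℂ (Fin n → ℂ) → PolyRing n}
  {c d : Submodule ℂ (Fin n → ℂ) → ℕ}

variable (G χ c) in
/-- The linear character `χ` restricts to the power `det ^ c_H` on the pointwise fixer of every
reflecting hyperplane `H`, and the exponents `c` are constant on `G`-orbits. The exponents are only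
determined modulo the orders `e_H`. -/
structure HasExponents : Prop where
  smul_eq (g : G) (H : Submodule ℂ (Fin n → ℂ)) : c (g • H) = c H
  apply_eq (H : Submodule ℂ (Fin n → ℂ)) (hH : H ∈ reflectingHyperplanes G) (s : G)
    (hs : s ∈ fixer G H) : χ s = detChar G s ^ c H

theorem hasExponents_one : HasExponents G 1 0 :=
  ⟨fun _ _ => rfl, fun _ _ _ _ => (pow_zero _).symm⟩

theorem hasExponents_detChar : HasExponents G (detChar G) 1 :=
  ⟨fun _ _ => rfl, fun _ _ _ _ => (pow_one _).symm⟩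

theorem HasExponents.mul (hχ : HasExponents G χ c) (hψ : HasExponents G ψ d) :
    HasExponents G (χ * ψ) (c + d) where
  smul_eq g H := by rw [Pi.add_apply, Pi.add_apply, hχ.smul_eq, hψ.smul_eq]
  apply_eq H hH s hs := by
    rw [MonoidHom.mul_apply, hχ.apply_eq H hH s hs, hψ.apply_eq H hH s hs, Pi.add_apply, pow_add]

theorem HasExponents.pow (hχ : HasExponents G χ c) (k : ℕ) : HasExponents G (χ ^ k) (k • c) where
  smul_eq g H := by rw [Pi.smul_apply, Pi.smul_apply, hχ.smul_eq]
  apply_eq H hH s hs := by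
    rw [MonoidHom.pow_apply, hχ.apply_eq H hH s hs, Pi.smul_apply, smul_eq_mul, mul_comm, pow_mul]

theorem HasExponents.of_modEq (hχ : HasExponents G χ c) (hd : ∀ (g : G) H, d (g • H) = d H)
    (h : ∀ H ∈ reflectingHyperplanes G, c H ≡ d H [MOD fixerOrder G H]) :
    HasExponents G χ d where
  smul_eq := hd
  apply_eq H hH s hs := by
    rw [hχ.apply_eq H hH s hs, pow_eq_pow_mod _ (detChar_pow_fixerOrder hs), h H hH,
      ← pow_eq_pow_mod _ (detChar_pow_fixerOrder hs)]

section Finite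

variable [Finite G] (hα : ∀ H ∈ reflectingHyperplanes G, IsDefiningForm H (α H))
include hα

theorem hasExponents_of_formMonomial_mem_isotypic (hc : ∀ (g : G) H, c (g • H) = c H)
    (hmem : formMonomial G α c ∈ isotypic G χ) : HasExponents G χ c where
  smul_eq := hc
  apply_eq H hH s hs := by
    rw [formMonomial_eq_pow_mul hH] at hmem
    exact eq_detChar_pow_of_mem_isotypic hH.1 (hα H hH) hmem
      (not_dvd_formMonomial hα hH (by simp)) hs

theorem exists_formMonomial_mem_isotypic (hc : ∀ (g : G) H, c (g • H) = c H) :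
    ∃ χ : G →* ℂˣ, formMonomial G α c ∈ isotypic G χ :=
  exists_mem_isotypic (formMonomial_ne_zero hα) fun g => associated_act_formMonomial hα (hc g)

theorem HasExponents.formMonomial_mem_isotypic (hG : IsReflectionGroup G)
    (hχ : HasExponents G χ c) : formMonomial G α c ∈ isotypic G χ := by
  obtain ⟨ψ, hψ⟩ := exists_formMonomial_mem_isotypic hα hχ.smul_eq
  have hψc := hasExponents_of_formMonomial_mem_isotypic hα hχ.smul_eq hψ
  rwa [hG.monoidHom_ext fun H hH s hs => (hχ.apply_eq H hH s hs).trans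
    (hψc.apply_eq H hH s hs).symm]

theorem formMonomial_mem_invariantRing (hG : IsReflectionGroup G)
    (hc : ∀ (g : G) H, c (g • H) = c H)
    (hdvd : ∀ H ∈ reflectingHyperplanes G, fixerOrder G H ∣ c H) :
    formMonomial G α c ∈ invariantRing G := by
  have hone : HasExponents G 1 c := hasExponents_one.of_modEq hc fun H hH =>
    (Nat.modEq_zero_iff_dvd.mpr (hdvd H hH)).symm
  exact mem_isotypic_one.mp (hone.formMonomial_mem_isotypic hα hG)

end Finite

/-- As `det ^ k ≠ 1` on the fixer of `H`, the polynomial `f` vanishes on `H`; dividing it by the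
form lowers `k` by one. -/
theorem IsDefiningForm.pow_dvd_of_act_eq [Finite G] (hH : IsCoatom H) (ha : IsDefiningForm H a)
    {k : ℕ} (hk : k < fixerOrder G H)
    (hf : ∀ s ∈ fixer G H, act s.1 f = C (detChar G s ^ k : ℂ) * f) : a ^ k ∣ f := by
  induction k generalizing f with
  | zero => simp
  | succ k ih =>
    obtain ⟨s, hs, hdet⟩ := exists_detChar_pow_ne_one hH k.succ_ne_zero hk
    have hvanish : ∀ v ∈ H, eval v f = 0 := fun v hv => by
      have h := congrArg (eval v) (hf s hs)
      rw [FixesPointwise.eval_act hs hv, map_mul, eval_C] at h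
      by_contra hfv
      exact hdet (Units.ext (by simpa using (right_eq_mul₀ hfv).mp h))
    obtain ⟨q, rfl⟩ := (ha.dvd_iff hH).mpr hvanish
    rw [pow_succ']
    refine mul_dvd_mul_left a (ih (k.lt_succ_self.trans hk) fun t ht => ?_)
    have hC : (C (detChar G t : ℂ) : PolyRing n) ≠ 0 := by simp
    have h := hf t ht
    rw [map_mul, ha.act_eq_detChar hH ht, pow_succ', C_mul] at h
    refine mul_left_cancel₀ (mul_ne_zero hC (ha.ne_zero hH)) ?_
    linear_combination h

variable [Finite G] (hα : ∀ H ∈ reflectingHyperplanes G, IsDefiningForm H (α H))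
  (hG : IsReflectionGroup G)
include hα hG

theorem HasExponents.isotypic_eq_span (hχ : HasExponents G χ c)
    (hlt : ∀ H ∈ reflectingHyperplanes G, c H < fixerOrder G H) :
    isotypic G χ = Submodule.span (invariantRing G) {formMonomial G α c} := by
  have hmem := hχ.formMonomial_mem_isotypic hα hG
  refine le_antisymm (fun f hf => ?_) (Submodule.span_le.mpr (Set.singleton_subset_iff.mpr hmem))
  obtain ⟨q, rfl⟩ : formMonomial G α c ∣ f := formMonomial_dvd hα fun H hH =>
    (hα H hH).pow_dvd_of_act_eq hH.1 (hlt H hH) fun s hs => by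
      rw [hf s, hχ.apply_eq H hH s hs, Units.val_pow_eq_pow_val]
  have hq := mem_invariantRing_of_mul_mem_isotypic (formMonomial_ne_zero hα) hmem hf
  exact Submodule.mem_span_singleton.mpr ⟨⟨q, hq⟩, mul_comm _ _⟩

theorem HasExponents.exists_linearEquiv_isotypic (hχ : HasExponents G χ c)
    (hlt : ∀ H ∈ reflectingHyperplanes G, c H < fixerOrder G H) :
    ∃ e : invariantRing G ≃ₗ[invariantRing G] isotypic G χ,
      ∀ r : invariantRing G, (e r : PolyRing n) = r * formMonomial G α c := by
  have hinj : Function.Injective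
      (LinearMap.toSpanSingleton (invariantRing G) (PolyRing n) (formMonomial G α c)) :=
    fun _ _ h => Subtype.ext (mul_right_cancel₀ (formMonomial_ne_zero hα) h)
  have hrange := (hχ.isotypic_eq_span hα hG hlt).trans (LinearMap.range_toSpanSingleton _).symm
  exact ⟨(LinearEquiv.ofInjective _ hinj).trans (LinearEquiv.ofEq _ _ hrange.symm), fun _ => rfl⟩

theorem HasExponents.nonempty_cokerMul_equiv (hχ : HasExponents G χ c)
    (hc : ∀ H ∈ reflectingHyperplanes G, c H < fixerOrder G H) (hψ : HasExponents G ψ d)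
    (hd : ∀ H ∈ reflectingHyperplanes G, d H < fixerOrder G H) {z : PolyRing n}
    {D : invariantRing G} (hD : z * formMonomial G α c = D * formMonomial G α d)
    (hmul : ∀ f ∈ isotypic G χ, z * f ∈ isotypic G ψ) :
    Nonempty (CokerMul G z χ ψ hmul ≃ₗ[invariantRing G] invariantRing G ⧸ Ideal.span {D}) := by
  obtain ⟨eχ, heχ⟩ := hχ.exists_linearEquiv_isotypic hα hG hc
  obtain ⟨eψ, heψ⟩ := hψ.exists_linearEquiv_isotypic hα hG hd
  refine nonempty_quotient_range_equiv (mulRestrict G z χ ψ hmul) eχ eψ (Subtype.ext ?_)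
  rw [heψ, ← hD]
  exact congrArg (z * ·) ((heχ 1).trans (one_mul _))

end Exponents

section Reynolds

variable {χ ψ : G →* ℂˣ} [Fintype G]

/-- The Reynolds operator of a linear character `χ`: the `R`-linear projection of `S` onto the
isotypical component of `χ`, obtained by averaging over `G`. -/
noncomputable def reynolds (χ : G →* ℂˣ) : PolyRing n →ₗ[invariantRing G] isotypic G χ where
  toFun f := ⟨C (Fintype.card G : ℂ)⁻¹ * ∑ g : G, C (χ g : ℂ)⁻¹ * act g.1 f, fun h => by
    rw [map_mul, act_C, map_sum, mul_left_comm]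
    congr 1
    rw [Finset.mul_sum]
    refine Fintype.sum_equiv (Equiv.mulLeft h) _ _ fun g => ?_
    rw [Equiv.coe_mulLeft, map_mul, act_C, Subgroup.coe_mul, act_mul, ← mul_assoc, ← C_mul,
      map_mul χ, Units.val_mul, mul_inv, mul_inv_cancel_left₀ (Units.ne_zero _)]⟩
  map_add' f p := Subtype.ext <| by
    simp only [map_add, mul_add, Finset.sum_add_distrib, Submodule.coe_add]
  map_smul' r f := Subtype.ext <| by
    have hr : ∀ g : G, act g.1 (r • f) = r • act g.1 f := fun g => by
      rw [Subring.smul_def, smul_eq_mul, map_mul, r.2 g g.2, Subring.smul_def, smul_eq_mul]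
    simp only [hr, mul_smul_comm, ← Finset.smul_sum, RingHom.id_apply, Submodule.coe_smul]

theorem coe_reynolds (χ : G →* ℂˣ) (f : PolyRing n) :
    (reynolds χ f : PolyRing n) =
      C (Fintype.card G : ℂ)⁻¹ * ∑ g : G, C (χ g : ℂ)⁻¹ * act g.1 f := rfl

theorem reynolds_coe (f : isotypic G χ) : reynolds χ (f : PolyRing n) = f := by
  have hterm : ∀ g : G, C (χ g : ℂ)⁻¹ * act g.1 (f : PolyRing n) = (f : PolyRing n) := fun g => by
    rw [f.2 g, ← mul_assoc, ← C_mul, inv_mul_cancel₀ (Units.ne_zero _), C_1, one_mul]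
  have hcard : (Fintype.card G : ℂ) ≠ 0 := Nat.cast_ne_zero.mpr Fintype.card_ne_zero
  refine Subtype.ext ?_
  rw [coe_reynolds, Finset.sum_congr rfl fun g _ => hterm g, Finset.sum_const, Finset.card_univ,
    nsmul_eq_mul, ← mul_assoc, ← map_natCast (C : ℂ →+* PolyRing n), ← C_mul, inv_mul_cancel₀ hcard,
    C_1, one_mul]

theorem reynolds_mul (hf : f ∈ isotypic G ψ) (p : PolyRing n) :
    (reynolds (χ * ψ) (f * p) : PolyRing n) = f * reynolds χ p := by
  rw [coe_reynolds, coe_reynolds, mul_left_comm]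
  congr 1
  rw [Finset.mul_sum]
  refine Finset.sum_congr rfl fun g _ => ?_
  have hψ : (C (ψ g : ℂ)⁻¹ : PolyRing n) * C (ψ g : ℂ) = 1 := by
    rw [← C_mul, inv_mul_cancel₀ (Units.ne_zero _), C_1]
  rw [map_mul, hf g, MonoidHom.mul_apply, Units.val_mul, mul_inv, C_mul]
  linear_combination (C (χ g : ℂ)⁻¹ * f * act g.1 p) * hψ

end Reynolds

section Summand

variable [Finite G] {χ ψ : G →* ℂˣ} {z : PolyRing n}

theorem exists_cokerMul_retraction (hz : z ∈ isotypic G ψ)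
    (hmul : ∀ f ∈ isotypic G χ, z * f ∈ isotypic G (χ * ψ)) :
    ∃ (i : CokerMul G z χ (χ * ψ) hmul →ₗ[invariantRing G] PolyRing n ⧸ Ideal.span {z})
      (r : PolyRing n ⧸ Ideal.span {z} →ₗ[invariantRing G] CokerMul G z χ (χ * ψ) hmul),
      Function.LeftInverse r i ∧
        ∀ f : isotypic G (χ * ψ), i (Submodule.Quotient.mk f) = Ideal.Quotient.mk _ f.1 := by
  have := Fintype.ofFinite G
  let I : Submodule (invariantRing G) (PolyRing n) := (Ideal.span {z}).restrictScalars _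
  let e : (PolyRing n ⧸ I) ≃ₗ[invariantRing G] PolyRing n ⧸ Ideal.span {z} :=
    Submodule.Quotient.restrictScalarsEquiv _ _
  have hi : LinearMap.range (mulRestrict G z χ (χ * ψ) hmul) ≤
      I.comap (isotypic G (χ * ψ)).subtype := by
    rintro _ ⟨f, rfl⟩
    exact Ideal.mem_span_singleton.mpr (dvd_mul_right z f)
  have hr : I ≤ (LinearMap.range (mulRestrict G z χ (χ * ψ) hmul)).comap (reynolds (χ * ψ)) := by
    intro f hf
    obtain ⟨p, rfl⟩ := Ideal.mem_span_singleton.mp hf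
    exact ⟨reynolds χ p, Subtype.ext (reynolds_mul hz p).symm⟩
  refine ⟨e.toLinearMap ∘ₗ Submodule.mapQ _ _ _ hi, Submodule.mapQ _ _ _ hr ∘ₗ e.symm.toLinearMap,
    fun x => ?_, fun f => rfl⟩
  obtain ⟨f, rfl⟩ := Submodule.Quotient.mk_surjective _ x
  exact congrArg Submodule.Quotient.mk (reynolds_coe f)

theorem exists_cokerMul_summand {Δ D : invariantRing G}
    (tS : Module.IsTorsionBySet (invariantRing G) (PolyRing n ⧸ Ideal.span {z})
      (Ideal.span {Δ} : Ideal (invariantRing G)))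
    (tD : Module.IsTorsionBySet (invariantRing G) (invariantRing G ⧸ Ideal.span {D})
      (Ideal.span {Δ} : Ideal (invariantRing G)))
    (hz : z ∈ isotypic G ψ) (hmul : ∀ f ∈ isotypic G χ, z * f ∈ isotypic G (χ * ψ))
    (hcoker : Nonempty (CokerMul G z χ (χ * ψ) hmul
      ≃ₗ[invariantRing G] invariantRing G ⧸ Ideal.span {D})) :
    letI := tS.module
    letI := tD.module
    ∃ tC : Module.IsTorsionBySet (invariantRing G) (CokerMul G z χ (χ * ψ) hmul)
        (Ideal.span {Δ} : Ideal (invariantRing G)),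
      letI := tC.module
      Nonempty (CokerMul G z χ (χ * ψ) hmul
        ≃ₗ[invariantRing G ⧸ Ideal.span {Δ}] (invariantRing G ⧸ Ideal.span {D})) ∧
      ∃ (P Q : Submodule (invariantRing G ⧸ Ideal.span {Δ}) (PolyRing n ⧸ Ideal.span {z}))
        (φ : CokerMul G z χ (χ * ψ) hmul ≃ₗ[invariantRing G ⧸ Ideal.span {Δ}] P),
        IsCompl P Q ∧ ∀ f : isotypic G (χ * ψ),
          (φ (Submodule.Quotient.mk f) : PolyRing n ⧸ Ideal.span {z}) =
            Ideal.Quotient.mk (Ideal.span {z}) (f : PolyRing n) := by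
  obtain ⟨ε⟩ := hcoker
  obtain ⟨i, r, hri, hi⟩ := exists_cokerMul_retraction hz hmul
  have tC : Module.IsTorsionBySet (invariantRing G) (CokerMul G z χ (χ * ψ) hmul)
      (Ideal.span {Δ} : Ideal (invariantRing G)) := by
    rw [Module.isTorsionBySet_iff_subset_annihilator] at tD ⊢
    rwa [ε.annihilator_eq]
  obtain ⟨P, Q, φ, hPQ, hφ⟩ := exists_isCompl_quotient_of_leftInverse tC tS i r hri
  exact ⟨tC, nonempty_linearEquiv_quotient tC tD ε, P, Q, φ, hPQ, fun f => (hφ _).trans (hi f)⟩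

end Summand

section Orbit

variable {T O : Set (Submodule ℂ (Fin n → ℂ))}

theorem mem_hyperplaneOrbits_iff :
    O ∈ hyperplaneOrbits G ↔ ∃ H ∈ reflectingHyperplanes G, O = MulAction.orbit G H := by
  refine exists_congr fun H => and_congr_right fun _ => ?_
  have horbit : {K | ∃ g ∈ G, K = g • H} = MulAction.orbit G H :=
    Set.ext fun K => ⟨fun ⟨g, hg, hK⟩ => ⟨⟨g, hg⟩, hK.symm⟩, fun ⟨g, hK⟩ => ⟨g, g.2, hK.symm⟩⟩
  rw [← horbit]
  rfl

theorem orbit_subset_reflectingHyperplanes (hH : H ∈ reflectingHyperplanes G) :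
    MulAction.orbit G H ⊆ reflectingHyperplanes G := by
  rintro _ ⟨g, rfl⟩
  exact smul_mem_reflectingHyperplanes g hH

theorem fixerOrder_eq_of_mem_orbit (hK : K ∈ MulAction.orbit G H) :
    fixerOrder G K = fixerOrder G H := by
  obtain ⟨g, rfl⟩ := hK
  exact fixerOrder_smul g H

theorem smul_mem_orbit_iff (H : Submodule ℂ (Fin n → ℂ)) (g : G) (K : Submodule ℂ (Fin n → ℂ)) :
    g • K ∈ MulAction.orbit G H ↔ K ∈ MulAction.orbit G H := by
  rw [← MulAction.orbit_eq_iff, MulAction.orbit_smul, MulAction.orbit_eq_iff]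

theorem indicator_smul (hT : ∀ (g : G) K, g • K ∈ T ↔ K ∈ T)
    {c : Submodule ℂ (Fin n → ℂ) → ℕ} (hc : ∀ (g : G) K, c (g • K) = c K) (g : G)
    (K : Submodule ℂ (Fin n → ℂ)) : T.indicator c (g • K) = T.indicator c K := by
  classical simp only [Set.indicator_apply, hT, hc]

variable [Finite G] {α : Submodule ℂ (Fin n → ℂ) → PolyRing n}
  (hα : ∀ H ∈ reflectingHyperplanes G, IsDefiningForm H (α H))
include hα

theorem exists_character_of_stable (hTA : T ⊆ reflectingHyperplanes G)
    (hT : ∀ (g : G) K, g • K ∈ T ↔ K ∈ T) :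
    ∃ θ : G →* ℂˣ, ∏ᶠ H ∈ T, α H ∈ isotypic G θ ∧ HasExponents G θ (T.indicator 1) := by
  have hone := indicator_smul hT (c := 1) fun _ _ => rfl
  obtain ⟨θ, hθ⟩ := exists_formMonomial_mem_isotypic hα hone
  refine ⟨θ, ?_, hasExponents_of_formMonomial_mem_isotypic hα hone hθ⟩
  simpa only [formMonomial_indicator hTA, Pi.one_apply, pow_one] using hθ

variable (hG : IsReflectionGroup G)
include hG

theorem formMonomial_indicator_mem_invariantRing (hT : ∀ (g : G) K, g • K ∈ T ↔ K ∈ T) :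
    formMonomial G α (T.indicator (fixerOrder G)) ∈ invariantRing G := by
  refine formMonomial_mem_invariantRing hα hG (indicator_smul hT fixerOrder_smul) fun K _ => ?_
  by_cases hK : K ∈ T <;> simp [hK]

theorem exists_discriminants (hT : ∀ (g : G) K, g • K ∈ T ↔ K ∈ T) :
    ∃ Δ ΔT : invariantRing G, (Δ : PolyRing n) = formMonomial G α (fixerOrder G) ∧
      (ΔT : PolyRing n) = formMonomial G α (T.indicator (fixerOrder G)) ∧ ΔT ∣ Δ := by
  have hTc : ∀ (g : G) K, g • K ∈ Tᶜ ↔ K ∈ Tᶜ := fun g K => not_congr (hT g K)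
  let ΔT : invariantRing G := ⟨_, formMonomial_indicator_mem_invariantRing hα hG hT⟩
  let ΔTc : invariantRing G := ⟨_, formMonomial_indicator_mem_invariantRing hα hG hTc⟩
  refine ⟨ΔT * ΔTc, ΔT, ?_, rfl, dvd_mul_right _ _⟩
  rw [Subring.coe_mul, formMonomial_mul, Set.indicator_self_add_compl]

theorem nonempty_cokerMul_equiv_of_stable (hTA : T ⊆ reflectingHyperplanes G)
    (hT : ∀ (g : G) K, g • K ∈ T ↔ K ∈ T) {m : ℕ}
    (hm : ∀ K ∈ T, fixerOrder G K = m) {θ : G →* ℂˣ} (hθ : HasExponents G θ (T.indicator 1))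
    {D : invariantRing G} (hD : (D : PolyRing n) = formMonomial G α (T.indicator (fixerOrder G)))
    (hmul : ∀ f ∈ isotypic G (θ ^ (m - 1)),
      formMonomial G α 1 * f ∈ isotypic G (θ ^ (m - 1) * detChar G)) :
    Nonempty (CokerMul G (formMonomial G α 1) (θ ^ (m - 1)) (θ ^ (m - 1) * detChar G) hmul
      ≃ₗ[invariantRing G] invariantRing G ⧸ Ideal.span {D}) := by
  have hTc : ∀ (g : G) K, g • K ∈ Tᶜ ↔ K ∈ Tᶜ := fun g K => not_congr (hT g K)
  have hpos : ∀ K ∈ T, 1 < m := fun K hK => hm K hK ▸ one_lt_fixerOrder (hTA hK)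
  have hsource : HasExponents G (θ ^ (m - 1)) ((m - 1) • T.indicator 1) := hθ.pow (m - 1)
  have htarget : HasExponents G (θ ^ (m - 1) * detChar G) (Tᶜ.indicator 1) := by
    refine (hsource.mul hasExponents_detChar).of_modEq (indicator_smul hTc fun _ _ => rfl)
      fun K _ => ?_
    by_cases hK : K ∈ T
    · have := hpos K hK
      simp [hK, hm K hK, Nat.ModEq, Nat.sub_add_cancel this.le]
    · simp [hK, Nat.ModEq.refl]
  refine hsource.nonempty_cokerMul_equiv hα hG (fun K hK => ?_) htarget (fun K hK => ?_) ?_ hmul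
  · by_cases hKT : K ∈ T
    · simpa [hKT, hm K hKT] using zero_lt_one.trans (hpos K hKT)
    · simpa [hKT] using zero_lt_one.trans (one_lt_fixerOrder hK)
  · exact (Set.indicator_le_self Tᶜ 1 K).trans_lt (one_lt_fixerOrder hK)
  · rw [hD, formMonomial_mul, formMonomial_mul]
    congr 1
    funext K
    by_cases hK : K ∈ T
    · simp [hK, hm K hK, Nat.add_sub_cancel' (hpos K hK).le]
    · simp [hK]

end Orbit

end ComplexReflection

theorem mainTheorem9 {n : ℕ} (G : Subgroup (GL (Fin n) ℂ)) [Finite G]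
    (hG : IsReflectionGroup G)
    (α : Submodule ℂ (Fin n → ℂ) → PolyRing n)
    (hα : ∀ H ∈ reflectingHyperplanes G, IsDefiningForm H (α H))
    (z : PolyRing n) (hz : z = ∏ᶠ H ∈ reflectingHyperplanes G, α H)
    (O : Set (Submodule ℂ (Fin n → ℂ))) (hO : O ∈ hyperplaneOrbits G) :
    -- the discriminant and its factor belonging to the orbit lie in the invariant ring
    ∃ Δ ΔO : invariantRing G,
      (Δ : PolyRing n) = ∏ᶠ H ∈ reflectingHyperplanes G, α H ^ fixerOrder G H ∧
      (ΔO : PolyRing n) = ∏ᶠ H ∈ O, α H ^ fixerOrder G H ∧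
    -- `S/(z)` and `R/(ΔO)` are modules over `R/(Δ)`
    ∃ (tS : Module.IsTorsionBySet (invariantRing G) (PolyRing n ⧸ Ideal.span {z})
          (Ideal.span {Δ} : Ideal (invariantRing G)))
      (tO : Module.IsTorsionBySet (invariantRing G) (invariantRing G ⧸ Ideal.span {ΔO})
          (Ideal.span {Δ} : Ideal (invariantRing G))),
      letI := tS.module
      letI := tO.module
      IsDirectSummand (invariantRing G ⧸ Ideal.span {Δ})
        (invariantRing G ⧸ Ideal.span {ΔO}) (PolyRing n ⧸ Ideal.span {z}) ∧
    -- the linear character of the orbit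
    ∃ θ : G →* ℂˣ,
      (∀ g : G, act (g : GL (Fin n) ℂ) (∏ᶠ H ∈ O, α H) =
        MvPolynomial.C (θ g : ℂ) * ∏ᶠ H ∈ O, α H) ∧
    -- the summand is the cokernel of `z` on the isotypical component of `θ ^ (e_H - 1)`
    ∀ H ∈ O,
      ∃ (hmul : ∀ f ∈ isotypic G (θ ^ (fixerOrder G H - 1)),
          z * f ∈ isotypic G (θ ^ (fixerOrder G H - 1) * detChar G))
        (tC : Module.IsTorsionBySet (invariantRing G)
          (CokerMul G z (θ ^ (fixerOrder G H - 1)) (θ ^ (fixerOrder G H - 1) * detChar G) hmul)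
          (Ideal.span {Δ} : Ideal (invariantRing G))),
        letI := tC.module
        Nonempty
          (CokerMul G z (θ ^ (fixerOrder G H - 1)) (θ ^ (fixerOrder G H - 1) * detChar G) hmul
            ≃ₗ[invariantRing G ⧸ Ideal.span {Δ}] (invariantRing G ⧸ Ideal.span {ΔO})) ∧
        -- the map induced by the inclusion of the isotypical component in `S` identifies the
        -- cokernel with a direct summand of `S/(z)`
        ∃ (P Q : Submodule (invariantRing G ⧸ Ideal.span {Δ}) (PolyRing n ⧸ Ideal.span {z}))
          (φ : CokerMul G z (θ ^ (fixerOrder G H - 1))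
              (θ ^ (fixerOrder G H - 1) * detChar G) hmul
            ≃ₗ[invariantRing G ⧸ Ideal.span {Δ}] P),
          IsCompl P Q ∧
          ∀ f : isotypic G (θ ^ (fixerOrder G H - 1) * detChar G),
            (φ (Submodule.Quotient.mk f) : PolyRing n ⧸ Ideal.span {z}) =
              Ideal.Quotient.mk (Ideal.span {z}) (f : PolyRing n) := by
  obtain ⟨H₀, hH₀, rfl⟩ := mem_hyperplaneOrbits_iff.mp hO
  have hOA := orbit_subset_reflectingHyperplanes hH₀
  have hstable := smul_mem_orbit_iff (G := G) H₀
  obtain rfl : z = formMonomial G α 1 := by simpa only [formMonomial, Pi.one_apply, pow_one]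
  have hzdet := hasExponents_detChar.formMonomial_mem_isotypic hα hG
  obtain ⟨Δ, ΔO, hΔ, hΔO, hΔdvd⟩ := exists_discriminants hα hG hstable
  have hzdvd : formMonomial G α 1 ∣ (Δ : PolyRing n) := hΔ ▸
    formMonomial_dvd_formMonomial fun H hH => (one_lt_fixerOrder hH).le
  have tS := isTorsionBySet_span_quotient_span (A := invariantRing G) hzdvd
  have tO := isTorsionBySet_span_quotient_span (A := invariantRing G) hΔdvd
  obtain ⟨θ, hθ, hexp⟩ := exists_character_of_stable hα hOA hstable
  have hmul (k : ℕ) (f : PolyRing n) (hf : f ∈ isotypic G (θ ^ k)) :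
      formMonomial G α 1 * f ∈ isotypic G (θ ^ k * detChar G) :=
    mul_comm f _ ▸ mul_mem_isotypic hf hzdet
  have hsummand := fun H (hH : H ∈ MulAction.orbit G H₀) =>
    have hconst := fun K (hK : K ∈ MulAction.orbit G H₀) =>
      (fixerOrder_eq_of_mem_orbit hK).trans (fixerOrder_eq_of_mem_orbit hH).symm
    exists_cokerMul_summand tS tO hzdet (hmul (fixerOrder G H - 1))
      (nonempty_cokerMul_equiv_of_stable hα hG hOA hstable hconst hexp hΔO _)
  refine ⟨Δ, ΔO, hΔ, hΔO.trans (formMonomial_indicator hOA), tS, tO, ?_, θ, hθ,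
    fun H hH => ⟨hmul _, hsummand H hH⟩⟩
  obtain ⟨tC, ⟨ε⟩, P, Q, φ, hPQ, -⟩ := hsummand H₀ (MulAction.mem_orbit_self H₀)
  exact ⟨P, Q, hPQ, ⟨ε.symm.trans φ⟩⟩
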